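/- Let $\Sigma$ be a finite alphabet, let $\$\notin\Sigma$ be a delimiter symbol, and put $\Sigma_\$=\Sigma\cup\{\$\}$. Let $\Phi:\$\Sigma^*\$\to\mathbb{N}^{\Sigma_\$^2}$ be the bigram map: for a string $s\in\$\Sigma^*\$$ and symbols $i,j\in\Sigma_\$$, the entry $\Phi(s)_{i,j}$ is the number of occurrences (counting overlaps) of $ij$ as a contiguous substring of $s$. A string $w\in\Sigma^*$ is uniquely decodable if $\Phi^{-1}(\Phi(\$w\$))=\{\$w\$\}$; let $L_{\mathrm{UNIQ}}\subseteq\Sigma^*$ be the set of uniquely decodable strings. For $x\in\Sigma$ and $a,b\in\Sigma\setminus\{x\}$ (where $a=b$ is allowed) let $$K_{x,a,b}=L\bigl(\Sigma^*\,a\,x\,(\Sigma\setminus\{a\})^*\,b\,\Sigma^*\bigr)\cap L\bigl(\Sigma^*\,a\,(\Sigma\setminus\{x\})^*\,b\,\Sigma^*\bigr),$$ where $L(\mathbf R)$ is the language defined by the regular expression $\mathbf R$, and let $$L_{\mathrm{OBST}}=\bigcup_{x\in\Sigma}\ \bigcup_{a,b\in\Sigma\setminus\{x\}}K_{x,a,b}.$$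 Then $$L_{\mathrm{UNIQ}}=\Sigma^*\setminus L_{\mathrm{OBST}}.$$ Consequently, $L_{\mathrm{UNIQ}}$ is a regular language. -/

import Mathlib

open scoped Computability

namespace BigramDecoding

/-- The alphabet with a delimiter: a letter `c` is `some c`, the delimiter is `none`. -/
abbrev WithDelim (α : Type*) : Type _ := Option α

/-- The set of all strings `$ w $` with `w` a string over `α`. -/
def Delimited (α : Type*) : Set (List (WithDelim α)) :=
  {s | ∃ w : List α, s = [none] ++ w.map some ++ [none]}

/-- The delimited string `$ w $`. -/
def delimit {α : Type*} (w : List α) : Delimited α :=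
  ⟨[none] ++ w.map some ++ [none], w, rfl⟩

/-- The list of all bigrams (pairs of consecutive symbols) of `s`, from left to right, with
repetitions: the pairs `(s₀, s₁), (s₁, s₂), …`. -/
def bigrams {β : Type*} (s : List β) : List (β × β) := s.zip s.tail

open Classical in
/-- The bigram map: it sends a delimited string to the vector of the numbers of occurrences of
each bigram. -/
noncomputable def bigramMap {α : Type*} (s : Delimited α) : WithDelim α × WithDelim α → ℕ :=
  fun p => (bigrams s.1).count p

/-- The uniquely decodable strings: those `w` for which `$ w $` is the only delimited string with
the bigram counts of `$ w $`. -/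
def uniqLang (α : Type*) : Language α :=
  {w : List α | bigramMap ⁻¹' {bigramMap (delimit w)} = {delimit w}}

/-- The language of the one-letter words with letter in `S`. -/
def letters {α : Type*} (S : Set α) : Language α := {w : List α | ∃ c ∈ S, w = [c]}

/-- The language of the regular expression `Σ* a x (Σ∖{a})* b Σ*`. -/
def langI {α : Type*} (x a b : α) : Language α :=
  (letters Set.univ)∗ * letters {a} * letters {x} * (letters ({a}ᶜ))∗ * letters {b} *
    (letters Set.univ)∗

/-- The language of the regular expression `Σ* a (Σ∖{x})* b Σ*`. -/
def langJ {α : Type*} (x a b : α) : Language α :=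
  (letters Set.univ)∗ * letters {a} * (letters ({x}ᶜ))∗ * letters {b} * (letters Set.univ)∗

/-- The obstruction language of the triple `x, a, b`. -/
def langK {α : Type*} (x a b : α) : Language α := langI x a b ⊓ langJ x a b

/-- The language of all obstructions: the union of the languages `langK x a b` over all letters
`x` and all letters `a, b` different from `x` (where `a = b` is allowed). -/
def obstLang (α : Type*) : Language α :=
  {w : List α | ∃ x a b : α, a ≠ x ∧ b ≠ x ∧ w ∈ langK x a b}

end BigramDecoding

/-! A delimited string is an Eulerian walk in its bigram multigraph, so unique decodability says
that this walk is the only one. An obstruction gives two different segments `a x u b` and `a v b`.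
The conditions `a ∉ u`, `x ∉ v` keep them from overlapping, except that when `a = b` they may share
an endpoint; swapping them gives another word with the same bigrams
(`HasObstruction.exists_bigrams_perm`). Conversely, let two walks agree up to a letter `a` and then
leave it by `a y` and `a x`. The first walk takes `a x` later. If it could never return from there
to an earlier letter, then the second walk, having taken `a x` first, could not get back to take `a
y`. The return supplies the obstruction (`hasObstruction_of_perm_of_ne`). Regularity follows from
closure properties, checked by counting left quotients (Myhill–Nerode). -/

theorem List.exists_first_split {β : Type*} {l : List β} {P : β → Prop} (h : ∃ c ∈ l, P c) :
    ∃ u c v, l = u ++ c :: v ∧ P c ∧ ∀ d ∈ u, ¬ P d := by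
  induction l with
  | nil => simp at h
  | cons d t ih =>
    by_cases hd : P d
    · exact ⟨[], d, t, rfl, hd, by simp⟩
    · obtain ⟨u, c, v, rfl, hc, hu⟩ := ih (by simpa [hd] using h)
      exact ⟨d :: u, c, v, rfl, hc, by simpa [hd] using hu⟩

theorem List.exists_last_split {β : Type*} {l : List β} {P : β → Prop} (h : ∃ c ∈ l, P c) :
    ∃ u c v, l = u ++ c :: v ∧ P c ∧ ∀ d ∈ v, ¬ P d := by
  obtain ⟨u, c, v, h, hc, hu⟩ := List.exists_first_split (l := l.reverse) (P := P) (by simpa using h)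
  refine ⟨v.reverse, c, u.reverse, ?_, hc, by simpa using hu⟩
  simpa using congrArg List.reverse h

namespace BigramDecoding

/-! ### Bigrams, segment swaps and obstructions -/

section Bigrams

variable {β : Type*}

@[simp] theorem bigrams_nil : bigrams ([] : List β) = [] := rfl

@[simp] theorem bigrams_singleton (c : β) : bigrams [c] = [] := rfl

@[simp] theorem bigrams_cons_cons (c d : β) (l : List β) :
    bigrams (c :: d :: l) = (c, d) :: bigrams (d :: l) := rfl

theorem bigrams_append_cons (l m : List β) (c : β) :
    bigrams (l ++ c :: m) = bigrams (l ++ [c]) ++ bigrams (c :: m) := by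
  induction l with
  | nil => simp
  | cons d t ih => cases t <;> simp_all

theorem mem_bigrams_iff {l : List β} {c d : β} :
    (c, d) ∈ bigrams l ↔ ∃ u v, l = u ++ c :: d :: v := by
  constructor
  · induction l with
    | nil => simp
    | cons e t ih =>
      cases t with
      | nil => simp
      | cons f t =>
        rw [bigrams_cons_cons, List.mem_cons]
        rintro (h | h)
        · obtain ⟨rfl, rfl⟩ := Prod.mk.inj h
          exact ⟨[], t, rfl⟩
        · obtain ⟨u, v, h⟩ := ih h
          exact ⟨e :: u, v, by rw [h]; rfl⟩
  · rintro ⟨u, v, rfl⟩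
    rw [bigrams_append_cons]
    simp

/-- Cutting at the displayed letters `a`, `b` splits both bigram lists into the same five blocks in
different orders. -/
theorem bigrams_swap_perm (p m q s t : List β) (a b : β) :
    (bigrams (p ++ a :: (s ++ b :: (m ++ a :: (t ++ b :: q))))).Perm
      (bigrams (p ++ a :: (t ++ b :: (m ++ a :: (s ++ b :: q))))) := by
  have key : ∀ s t : List β, bigrams (p ++ a :: (s ++ b :: (m ++ a :: (t ++ b :: q)))) =
      bigrams (p ++ [a]) ++ (bigrams (a :: s ++ [b]) ++ (bigrams (b :: m ++ [a]) ++
        (bigrams (a :: t ++ [b]) ++ bigrams (b :: q)))) := by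
    intro s t
    rw [bigrams_append_cons, ← List.cons_append, bigrams_append_cons (a :: s),
      ← List.cons_append, bigrams_append_cons (b :: m), ← List.cons_append,
      bigrams_append_cons (a :: t)]
  rw [key, key, ← Multiset.coe_eq_coe]
  simp only [← Multiset.coe_add]
  abel

/-- The case `a = b` of two segments sharing an endpoint: adjacent loops at `a` commute. -/
theorem bigrams_swap_perm_of_loops (p q s t : List β) (a : β) :
    (bigrams (p ++ a :: (s ++ a :: (t ++ a :: q)))).Perm
      (bigrams (p ++ a :: (t ++ a :: (s ++ a :: q)))) := by
  have key : ∀ s t : List β, bigrams (p ++ a :: (s ++ a :: (t ++ a :: q))) =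
      bigrams (p ++ [a]) ++ (bigrams (a :: s ++ [a]) ++
        (bigrams (a :: t ++ [a]) ++ bigrams (a :: q))) := by
    intro s t
    rw [bigrams_append_cons, ← List.cons_append, bigrams_append_cons (a :: s),
      ← List.cons_append, bigrams_append_cons (a :: t)]
  rw [key, key, ← Multiset.coe_eq_coe]
  simp only [← Multiset.coe_add]
  abel

/-- A string that contains `a x u b` with `a ∉ u` and `a v b` with `x ∉ v`. -/
def HasObstruction (l : List β) : Prop :=
  ∃ x a b : β, a ≠ x ∧ b ≠ x ∧ (∃ p u q, l = p ++ a :: x :: (u ++ b :: q) ∧ a ∉ u) ∧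
    ∃ p v q, l = p ++ a :: (v ++ b :: q) ∧ x ∉ v

theorem HasObstruction.append_left {l : List β} (h : HasObstruction l) (k : List β) :
    HasObstruction (k ++ l) := by
  obtain ⟨x, a, b, hax, hbx, ⟨p, u, q, h1, hu⟩, p', v, q', h2, hv⟩ := h
  exact ⟨x, a, b, hax, hbx, ⟨k ++ p, u, q, by simp [h1], hu⟩, k ++ p', v, q', by simp [h2], hv⟩

/-- A string that starts with `a y` and can be rearranged to one that starts with `a x`, `x ≠ y`,
with the same bigrams, has an obstruction. -/
theorem hasObstruction_of_perm_of_ne {a x y : β} {l m : List β} (hxy : x ≠ y)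
    (h : (bigrams (a :: y :: l)).Perm (bigrams (a :: x :: m))) :
    HasObstruction (a :: y :: l) := by
  have hx : (a, x) ∈ bigrams (y :: l) := by
    have : (a, x) ∈ bigrams (a :: y :: l) := h.mem_iff.2 (by simp)
    simpa [hxy] using this
  have hy : (a, y) ∈ bigrams (x :: m) := by
    have : (a, y) ∈ bigrams (a :: x :: m) := h.mem_iff.1 (by simp)
    simpa [hxy.symm] using this
  -- The first occurrence of `a x`.
  obtain ⟨s, t, hst, hfirst⟩ : ∃ s t, y :: l = s ++ a :: x :: t ∧ (a, x) ∉ bigrams (s ++ [a]) := by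
    clear h hy
    generalize y :: l = k at hx
    induction k with
    | nil => simp at hx
    | cons c k ih =>
      cases k with
      | nil => simp at hx
      | cons d k =>
        by_cases hcd : a = c ∧ x = d
        · obtain ⟨rfl, rfl⟩ := hcd
          exact ⟨[], k, rfl, by simp⟩
        · obtain ⟨s, t, hst, hs⟩ := ih (by
            rw [bigrams_cons_cons, List.mem_cons, Prod.mk.injEq] at hx
            exact hx.resolve_left hcd)
          refine ⟨c :: s, t, by rw [hst]; rfl, ?_⟩
          cases s with
          | nil =>
            simp only [List.nil_append, List.cons.injEq] at hst
            rw [hst.1] at hcd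
            simpa using hcd
          | cons e s =>
            simp only [List.cons_append, List.cons.injEq] at hst
            rw [hst.1] at hcd
            simpa [hcd] using hs
  by_cases hxa : x = a
  · subst hxa
    -- The bigram `a a` is the second segment, with `v` empty; the first is the initial `a y ⋯ a` up
    -- to the next `a`.
    obtain ⟨u, c, v, huv, hc, hu⟩ := List.exists_first_split (l := l) (P := (· = x)) (by
      cases s with
      | nil =>
        simp only [List.nil_append, List.cons.injEq] at hst
        exact absurd hst.1.symm hxy
      | cons e s =>
        simp only [List.cons_append, List.cons.injEq] at hst
        simp [hst.2])
    subst hc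
    exact ⟨y, c, c, hxy, hxy, ⟨[], u, v, by simp [huv], fun h => hu _ h rfl⟩,
      c :: s, [], t, by simp [hst], by simp⟩
  by_cases hxs : x ∈ s
  · obtain ⟨s₁, s₂, rfl⟩ := List.append_of_mem hxs
    -- From the last `a` before this early `x`, a segment runs to `x` without meeting `a`; the later
    -- bigram `a x` is the other segment, so `x` plays the role of `b`.
    obtain ⟨u, c, v, huv, hc, hv⟩ := List.exists_last_split (l := a :: s₁) (P := (· = a))
      ⟨a, by simp, rfl⟩
    subst hc
    have hw : c :: y :: l = u ++ c :: (v ++ x :: (s₂ ++ c :: x :: t)) := by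
      rw [hst, ← List.cons_append, ← List.cons_append, huv]; simp
    cases v with
    | nil =>
      -- An empty `v` would put `a x` before its first occurrence, or force `x = y` at the start.
      exfalso
      cases s₁ with
      | nil =>
        simp only [List.nil_append, List.cons_append, List.cons.injEq] at hst
        exact hxy hst.1.symm
      | cons e s₁ =>
        apply hfirst
        cases u with
        | nil => simp at huv
        | cons f u =>
          simp only [List.cons_append, List.cons.injEq] at huv
          rw [huv.2, mem_bigrams_iff]
          exact ⟨u, s₂ ++ [c], by simp⟩
    | cons z v =>
      refine ⟨z, c, x, fun h => hv z (by simp) h.symm, ?_,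
        ⟨u, v, _, hw, fun h => hv c (by simp [h]) rfl⟩, c :: (s₁ ++ x :: s₂), [], t, by simp [hst], by simp⟩
      rintro rfl
      apply hfirst
      cases u with
      | nil =>
        simp only [List.nil_append, List.cons_append, List.cons.injEq] at hw
        exact absurd hw.2.1.symm hxy
      | cons f u =>
        simp only [List.cons_append, List.cons.injEq] at huv
        rw [huv.2, mem_bigrams_iff]
        exact ⟨u, v ++ x :: (s₂ ++ [c]), by simp⟩
  · -- `a x` is not a bridge, so the string returns after `a x` to an earlier symbol.
    have hret : ∃ c ∈ t, c = a ∨ c ∈ s := by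
      by_contra! hno
      -- Without a return, the letters of `x :: t` are closed under successors. The other string
      -- enters this set at once, so it never reaches `a` again to use the bigram `a y`.
      have hstep : ∀ c d, (c, d) ∈ bigrams (a :: x :: m) → c ∈ x :: t → d ∈ x :: t := by
        intro c d hcd hc
        rw [← h.mem_iff, hst, ← List.cons_append, bigrams_append_cons, bigrams_cons_cons,
          List.mem_append, List.mem_cons] at hcd
        have hc' : c ≠ a ∧ c ∉ s := by
          rcases List.mem_cons.1 hc with rfl | hc
          · exact ⟨hxa, hxs⟩
          · exact hno c hc
        rcases hcd with hcd | hcd | hcd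
        · have := (List.of_mem_zip hcd).1
          simp [hc'] at this
        · simp at hcd
          exact absurd hcd.1 hc'.1
        · exact List.mem_of_mem_tail (List.of_mem_zip hcd).2
      have hall : ∀ (k : List β) (c : β), (∀ e ∈ bigrams (c :: k), e ∈ bigrams (a :: x :: m)) →
          c ∈ x :: t → ∀ d ∈ c :: k, d ∈ x :: t := by
        intro k
        induction k with
        | nil => intro c _ hc d hd; simp at hd; exact hd ▸ hc
        | cons e k ih =>
          intro c hk hc d hd
          rcases List.mem_cons.1 hd with rfl | hd
          · exact hc
          · refine ih e (fun f hf => hk f (by simp [hf])) (hstep c e (hk _ (by simp)) hc) d hd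
      have ha := hall m x (fun e he => by simp [he]) (by simp) a (List.of_mem_zip hy).1
      rcases List.mem_cons.1 ha with rfl | ha
      · exact hxa rfl
      · exact (hno a ha).1 rfl
    obtain ⟨u, b, q, rfl, hb, hu⟩ := List.exists_first_split hret
    have hbx : b ≠ x := by
      rintro rfl
      exact hb.elim hxa hxs
    refine ⟨x, a, b, Ne.symm hxa, hbx, ⟨a :: s, u, q, by simp [hst], fun h => hu a h (Or.inl rfl)⟩, ?_⟩
    have hbs : b ∈ s ++ [a] := by simpa [or_comm] using hb
    obtain ⟨v, v', hv⟩ := List.append_of_mem hbs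
    -- The second segment starts at the initial `a` and ends at `b` within `s ++ [a]`, which avoids
    -- `x`.
    refine ⟨[], v, v' ++ x :: (u ++ b :: q), ?_, fun hxv => ?_⟩
    · rw [hst, List.nil_append]
      have := congrArg (· ++ x :: (u ++ b :: q)) hv
      simp only [List.append_assoc, List.cons_append, List.nil_append] at this
      rw [this]
    · have : x ∈ s ++ [a] := by rw [hv]; simp [hxv]
      simp [hxa, hxs] at this

/-- Cancelling the common prefix leads to the first divergence, which comes after a shared letter
because the heads agree; neither string can end there, since the numbers of bigrams agree. -/
theorem hasObstruction_of_perm {l m : List β} (hlm : l ≠ m) (hhead : l.head? = m.head?)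
    (h : (bigrams l).Perm (bigrams m)) : HasObstruction l := by
  induction l generalizing m with
  | nil => cases m <;> simp_all
  | cons a l ih =>
    cases m with
    | nil => simp at hhead
    | cons a' m =>
      obtain rfl : a = a' := by simpa using hhead
      cases l with
      | nil =>
        cases m with
        | nil => exact absurd rfl hlm
        | cons x m => simp at h
      | cons y l =>
        cases m with
        | nil => simp at h
        | cons x m =>
          by_cases hxy : x = y
          · subst hxy
            exact (ih (m := x :: m) (fun h => hlm (by rw [h])) rfl
              (by simpa using h)).append_left [a]
          · exact hasObstruction_of_perm_of_ne hxy h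

/-- The segments of an obstruction can be swapped. -/
theorem HasObstruction.exists_bigrams_perm {γ : Type*} {l : List β} (h : HasObstruction l)
    (f : β → γ) : ∃ m, m ≠ l ∧ ∀ k k',
      (bigrams (k ++ (m.map f ++ k'))).Perm (bigrams (k ++ (l.map f ++ k'))) := by
  obtain ⟨x, a, b, hax, hbx, ⟨p, u, q, h1, hu⟩, p', v, q', h2, hv⟩ := h
  -- The letter after `a` tells the segments apart: `v ++ [b]` does not start with `x`. Hence a swap
  -- changes the word.
  have hne : ∀ P R R', P ++ a :: (v ++ b :: R) ≠ P ++ a :: x :: R' := by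
    intro P R R' h
    cases v with
    | nil => simp [hbx] at h
    | cons c v =>
      simp at h
      exact hv (by simp [h.1])
  -- `a x u b` precedes `a v b`
  have disj₁ : ∀ P M Q, l = P ++ a :: x :: (u ++ b :: (M ++ a :: (v ++ b :: Q))) →
      ∃ m, m ≠ l ∧ ∀ k k',
        (bigrams (k ++ (m.map f ++ k'))).Perm (bigrams (k ++ (l.map f ++ k'))) := by
    rintro P M Q rfl
    refine ⟨P ++ a :: (v ++ b :: (M ++ a :: (x :: u ++ b :: Q))), hne _ _ _, fun k k' => ?_⟩
    simpa using bigrams_swap_perm (k ++ P.map f) (M.map f)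
      (Q.map f ++ k') (v.map f) ((x :: u).map f) (f a) (f b)
  have disj₂ : ∀ P M Q, l = P ++ a :: (v ++ b :: (M ++ a :: x :: (u ++ b :: Q))) →
      ∃ m, m ≠ l ∧ ∀ k k',
        (bigrams (k ++ (m.map f ++ k'))).Perm (bigrams (k ++ (l.map f ++ k'))) := by
    rintro P M Q rfl
    refine ⟨P ++ a :: (x :: u ++ b :: (M ++ a :: (v ++ b :: Q))), (hne _ _ _).symm, fun k k' => ?_⟩
    simpa using bigrams_swap_perm (k ++ P.map f) (M.map f)
      (Q.map f ++ k') ((x :: u).map f) (v.map f) (f a) (f b)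
  have loop₁ : ∀ P Q, a = b → l = P ++ a :: x :: (u ++ b :: (v ++ b :: Q)) →
      ∃ m, m ≠ l ∧ ∀ k k',
        (bigrams (k ++ (m.map f ++ k'))).Perm (bigrams (k ++ (l.map f ++ k'))) := by
    rintro P Q rfl rfl
    refine ⟨P ++ a :: (v ++ a :: (x :: u ++ a :: Q)), hne _ _ _, fun k k' => ?_⟩
    simpa using bigrams_swap_perm_of_loops (k ++ P.map f)
      (Q.map f ++ k') (v.map f) ((x :: u).map f) (f a)
  have loop₂ : ∀ P Q, a = b → l = P ++ a :: (v ++ b :: x :: (u ++ b :: Q)) →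
      ∃ m, m ≠ l ∧ ∀ k k',
        (bigrams (k ++ (m.map f ++ k'))).Perm (bigrams (k ++ (l.map f ++ k'))) := by
    rintro P Q rfl rfl
    refine ⟨P ++ a :: (x :: u ++ a :: (v ++ a :: Q)), (hne _ _ _).symm, fun k k' => ?_⟩
    simpa using bigrams_swap_perm_of_loops (k ++ P.map f)
      (Q.map f ++ k') ((x :: u).map f) (v.map f) (f a)
  have h3 := h1.symm.trans h2
  -- Split by which segment starts first. An `a` inside `x u` is excluded, and so is an `a x` inside
  -- `a v b`; what remains is disjoint segments, or `a = b` with a shared endpoint.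
  rcases List.append_eq_append_iff.1 h3 with ⟨c, rfl, hc⟩ | ⟨c, rfl, hc⟩
  · cases c with
    | nil => exact absurd (by simpa using hc.symm) (hne [] q' (u ++ b :: q))
    | cons _ c =>
      simp only [List.cons_append, List.cons.injEq] at hc
      obtain ⟨rfl, hc⟩ := hc
      cases c with
      | nil => simp [hax.symm] at hc
      | cons _ c =>
        simp only [List.cons_append, List.cons.injEq] at hc
        obtain ⟨rfl, hc⟩ := hc
        rcases List.append_eq_append_iff.1 hc with ⟨d, rfl, hd⟩ | ⟨d, rfl, hd⟩
        · cases d with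
          | nil =>
            simp only [List.nil_append, List.cons.injEq] at hd
            exact loop₁ p q' hd.1.symm (by rw [h1, hd.2])
          | cons _ d =>
            simp only [List.cons_append, List.cons.injEq] at hd
            exact disj₁ p d q' (by rw [h1, hd.2])
        · cases d with
          | nil =>
            simp only [List.nil_append, List.cons.injEq] at hd
            exact loop₁ p q' hd.1 (by rw [h1, hd.2])
          | cons _ d =>
            simp only [List.cons_append, List.cons.injEq] at hd
            simp [hd.1] at hu
  · cases c with
    | nil => exact absurd (by simpa using hc) (hne [] q' (u ++ b :: q))
    | cons _ c =>
      simp only [List.cons_append, List.cons.injEq] at hc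
      obtain ⟨rfl, hc⟩ := hc
      rcases List.append_eq_append_iff.1 hc with ⟨d, rfl, hd⟩ | ⟨d, rfl, hd⟩
      · cases d with
        | nil =>
          simp only [List.nil_append, List.cons.injEq] at hd
          exact loop₂ p' q hd.1.symm (by rw [h2, hd.2])
        | cons _ d =>
          simp only [List.cons_append, List.cons.injEq] at hd
          exact disj₂ p' d q (by rw [h2, hd.2])
      · cases d with
        | nil =>
          simp only [List.nil_append, List.cons.injEq] at hd
          exact loop₂ p' q hd.1 (by rw [h2, hd.2])
        | cons _ d =>
          simp only [List.cons_append, List.cons.injEq] at hd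
          cases d with
          | nil => simp [hbx.symm] at hd
          | cons _ d =>
            simp only [List.cons_append, List.cons.injEq] at hd
            simp [hd.2.1] at hv

end Bigrams

/-! ### From languages and delimited strings to plain lists -/

section Languages

variable {α : Type*}

theorem mem_kstar_letters {S : Set α} {w : List α} : w ∈ (letters S)∗ ↔ ∀ c ∈ w, c ∈ S := by
  rw [Language.mem_kstar]
  constructor
  · rintro ⟨L, rfl, hL⟩ c hc
    obtain ⟨y, hy, hcy⟩ := List.mem_flatten.1 hc
    obtain ⟨d, hd, rfl⟩ := hL y hy
    rw [List.mem_singleton.1 hcy]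
    exact hd
  · intro h
    refine ⟨w.map fun c => [c], ?_, ?_⟩
    · clear h
      induction w with
      | nil => rfl
      | cons c w ih => rw [List.map_cons, List.flatten_cons, ← ih, List.singleton_append]
    intro y hy
    obtain ⟨c, hc, rfl⟩ := List.mem_map.1 hy
    exact ⟨c, h c hc, rfl⟩

theorem mem_mul_letters_singleton {L : Language α} {a : α} {w : List α} :
    w ∈ L * letters {a} ↔ ∃ u ∈ L, w = u ++ [a] := by
  rw [Language.mem_mul]
  constructor
  · rintro ⟨u, hu, _, ⟨_, rfl, rfl⟩, rfl⟩
    exact ⟨u, hu, rfl⟩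
  · rintro ⟨u, hu, rfl⟩
    exact ⟨u, hu, [a], ⟨a, rfl, rfl⟩, rfl⟩

theorem mem_mul_kstar_letters {L : Language α} {S : Set α} {w : List α} :
    w ∈ L * (letters S)∗ ↔ ∃ u ∈ L, ∃ v, (∀ c ∈ v, c ∈ S) ∧ w = u ++ v := by
  simp only [Language.mem_mul, mem_kstar_letters, eq_comm]

theorem mem_langI {x a b : α} {w : List α} :
    w ∈ langI x a b ↔ ∃ p u q, w = p ++ a :: x :: (u ++ b :: q) ∧ a ∉ u := by
  simp only [langI, mem_mul_kstar_letters, mem_mul_letters_singleton, mem_kstar_letters]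
  constructor
  · rintro ⟨_, ⟨_, ⟨_, ⟨_, ⟨p, -, rfl⟩, rfl⟩, u, hu, rfl⟩, rfl⟩, q, -, rfl⟩
    exact ⟨p, u, q, by simp, fun h => hu a h rfl⟩
  · rintro ⟨p, u, q, rfl, hu⟩
    exact ⟨_, ⟨_, ⟨_, ⟨_, ⟨p, by simp, rfl⟩, rfl⟩, u, fun c hc hca => hu (hca ▸ hc), rfl⟩, rfl⟩,
      q, by simp, by simp⟩

theorem mem_langJ {x a b : α} {w : List α} :
    w ∈ langJ x a b ↔ ∃ p v q, w = p ++ a :: (v ++ b :: q) ∧ x ∉ v := by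
  simp only [langJ, mem_mul_kstar_letters, mem_mul_letters_singleton, mem_kstar_letters]
  constructor
  · rintro ⟨_, ⟨_, ⟨_, ⟨p, -, rfl⟩, u, hu, rfl⟩, rfl⟩, q, -, rfl⟩
    exact ⟨p, u, q, by simp, fun h => hu x h rfl⟩
  · rintro ⟨p, u, q, rfl, hu⟩
    exact ⟨_, ⟨_, ⟨_, ⟨p, by simp, rfl⟩, u, fun c hc hca => hu (hca ▸ hc), rfl⟩, rfl⟩,
      q, by simp, by simp⟩

theorem mem_obstLang {w : List α} : w ∈ obstLang α ↔ HasObstruction w := by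
  change (∃ x a b : α, a ≠ x ∧ b ≠ x ∧ w ∈ langI x a b ⊓ langJ x a b) ↔ _
  simp only [HasObstruction, Language.mem_inf, mem_langI, mem_langJ]

theorem delimit_injective : Function.Injective (delimit : List α → Delimited α) := by
  intro v w h
  have := congrArg Subtype.val h
  simpa [delimit, (Option.some_injective α).list_map.eq_iff] using this

theorem delimit_surjective : Function.Surjective (delimit : List α → Delimited α) := by
  rintro ⟨_, w, rfl⟩
  exact ⟨w, rfl⟩

theorem bigramMap_eq_iff {s t : Delimited α} :
    bigramMap s = bigramMap t ↔ (bigrams s.1).Perm (bigrams t.1) := by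
  classical
  rw [List.perm_iff_count, funext_iff]
  simp only [bigramMap]

theorem mem_uniqLang {w : List α} :
    w ∈ uniqLang α ↔ ∀ v, (bigrams (delimit v).1).Perm (bigrams (delimit w).1) → v = w := by
  change bigramMap ⁻¹' {bigramMap (delimit w)} = {delimit w} ↔ _
  simp only [Set.ext_iff, delimit_surjective.forall, Set.mem_preimage, Set.mem_singleton_iff,
    bigramMap_eq_iff, delimit_injective.eq_iff]
  exact ⟨fun h v => (h v).1, fun h v => ⟨h v, fun hv => hv ▸ List.Perm.refl _⟩⟩

/-- The bigram between two letters, forgetting those with a delimiter. -/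
def innerBigram : WithDelim α × WithDelim α → Option (α × α)
  | (some c, some d) => some (c, d)
  | _ => none

/-- The letter that follows the delimiter in a bigram. -/
def initialLetter : WithDelim α × WithDelim α → Option α
  | (none, d) => d
  | _ => none

/-- The delimited bigrams determine the inner bigrams and the first letter, which is all that
`hasObstruction_of_perm` needs. -/
theorem bigrams_delimit (w : List α) :
    (bigrams (delimit w).1).filterMap innerBigram = bigrams w ∧
      (bigrams (delimit w).1).filterMap initialLetter = w.head?.toList := by
  have key : ∀ (c : α) (t : List α),
      (bigrams (some c :: (t.map some ++ [none]))).filterMap innerBigram = bigrams (c :: t) ∧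
      (bigrams (some c :: (t.map some ++ [none]))).filterMap initialLetter = [] := by
    intro c t
    induction t generalizing c with
    | nil => exact ⟨rfl, rfl⟩
    | cons d t ih =>
      rw [List.map_cons, List.cons_append, bigrams_cons_cons, List.filterMap_cons_some (f := innerBigram (α := α)) rfl,
        List.filterMap_cons_none (f := initialLetter) rfl, (ih d).1]
      exact ⟨rfl, (ih d).2⟩
  cases w with
  | nil => exact ⟨rfl, rfl⟩
  | cons c t =>
    change List.filterMap _ ((none, some c) :: bigrams (some c :: (t.map some ++ [none]))) = _ ∧
      List.filterMap _ ((none, some c) :: bigrams (some c :: (t.map some ++ [none]))) = _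
    rw [List.filterMap_cons_none (f := innerBigram) rfl, List.filterMap_cons_some (f := initialLetter (α := α)) rfl, (key c t).2]
    exact ⟨(key c t).1, rfl⟩

theorem uniqLang_eq_compl_obstLang : uniqLang α = (obstLang α)ᶜ := by
  ext w
  change w ∈ uniqLang α ↔ ¬ w ∈ obstLang α
  rw [mem_uniqLang, mem_obstLang]
  constructor
  · rintro h hw
    obtain ⟨m, hm, hperm⟩ := hw.exists_bigrams_perm some
    exact hm (h m (by simpa [delimit] using hperm [none] [none]))
  · intro hw v hv
    by_contra hne
    refine hw (hasObstruction_of_perm (m := v) (Ne.symm hne) ?_ ?_)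
    · have := (hv.filterMap initialLetter).symm
      rw [(bigrams_delimit v).2, (bigrams_delimit w).2] at this
      cases hv' : v.head? <;> cases hw' : w.head? <;> simp_all
    · have := (hv.filterMap innerBigram).symm
      rwa [(bigrams_delimit v).1, (bigrams_delimit w).1] at this

end Languages

/-! ### Regularity by finiteness of left quotients -/

section Regular

variable {α : Type*}

/-- The quotient of `L * M` by `w` is `(L.leftQuotient w) * M` plus the union of the quotients
`M.leftQuotient v` over splittings `w = u ++ v` with `u ∈ L`. It is thus determined by one quotient
of `L` and a set of quotients of `M`: finitely many choices. -/
theorem isRegular_mul {L M : Language α} (hL : L.IsRegular) (hM : M.IsRegular) :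
    (L * M).IsRegular := by
  rw [Language.isRegular_iff_finite_range_leftQuotient] at hL hM ⊢
  refine ((hL.prod hM.finite_subsets).image
    fun p : Language α × Set (Language α) => p.1 * M + (sSup p.2 : Language α)).subset ?_
  rintro _ ⟨w, rfl⟩
  refine ⟨(L.leftQuotient w, {N | ∃ u v, w = u ++ v ∧ u ∈ L ∧ N = M.leftQuotient v}),
    ⟨⟨w, rfl⟩, ?_⟩, ?_⟩
  · rintro _ ⟨u, v, -, -, rfl⟩
    exact ⟨v, rfl⟩
  · ext z
    change z ∈ L.leftQuotient w * M + sSup _ ↔ w ++ z ∈ L * M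
    rw [Language.add_def]
    change (z ∈ L.leftQuotient w * M ∨ z ∈ ⋃₀ {N : Set (List α) | _}) ↔ _
    simp only [Language.mem_mul, Language.mem_leftQuotient]
    constructor
    · rintro (⟨s, hs, t, ht, rfl⟩ | ⟨_, ⟨u, v, rfl, hu, rfl⟩, hz⟩)
      · exact ⟨w ++ s, hs, t, ht, by simp⟩
      · exact ⟨u, hu, v ++ z, hz, by simp⟩
    · rintro ⟨s, hs, t, ht, h⟩
      rcases List.append_eq_append_iff.1 h with ⟨c, rfl, rfl⟩ | ⟨c, rfl, rfl⟩
      · exact Or.inr ⟨_, ⟨s, c, rfl, hs, rfl⟩, ht⟩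
      · exact Or.inl ⟨c, hs, t, ht, rfl⟩

theorem isRegular_kstar_letters (S : Set α) : ((letters S)∗).IsRegular := by
  rw [Language.isRegular_iff_finite_range_leftQuotient]
  refine (Set.toFinite {(letters S)∗, (⊥ : Language α)}).subset ?_
  rintro _ ⟨w, rfl⟩
  by_cases hw : ∀ c ∈ w, c ∈ S
  · left
    ext z
    simp only [Language.mem_leftQuotient, mem_kstar_letters, List.mem_append]
    exact ⟨fun h c hc => h c (Or.inr hc), fun h c hc => hc.elim (hw c) (h c)⟩
  · right
    ext z
    simp only [Language.mem_leftQuotient, mem_kstar_letters, List.mem_append]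
    exact ⟨fun h => hw fun c hc => h c (Or.inl hc), fun h => h.elim⟩

theorem isRegular_letters (S : Set α) : (letters S).IsRegular := by
  rw [Language.isRegular_iff_finite_range_leftQuotient]
  refine (Set.toFinite {letters S, (1 : Language α), (⊥ : Language α)}).subset ?_
  rintro _ ⟨w, rfl⟩
  have key : ∀ z, z ∈ (letters S).leftQuotient w ↔ ∃ c ∈ S, w ++ z = [c] := fun _ => Iff.rfl
  rcases w with - | ⟨c, - | ⟨d, w⟩⟩
  · exact Or.inl rfl
  · right
    by_cases hc : c ∈ S
    · left
      ext z
      simp [key, Language.mem_one, hc]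
    · right
      ext z
      rw [key]
      refine ⟨?_, fun h => h.elim⟩
      rintro ⟨e, he, h⟩
      simp at h
      exact absurd (h.1 ▸ he) hc
  · right
    right
    ext z
    rw [key]
    refine ⟨?_, fun h => h.elim⟩
    rintro ⟨e, he, h⟩
    simp at h

theorem isRegular_langK (x a b : α) : (langK x a b).IsRegular := by
  have hk := isRegular_kstar_letters (α := α)
  have hl := isRegular_letters (α := α)
  refine Language.IsRegular.inf ?_ ?_
  · exact isRegular_mul (isRegular_mul (isRegular_mul (isRegular_mul (isRegular_mul
      (hk _) (hl _)) (hl _)) (hk _)) (hl _)) (hk _)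
  · exact isRegular_mul (isRegular_mul (isRegular_mul (isRegular_mul
      (hk _) (hl _)) (hk _)) (hl _)) (hk _)

theorem isRegular_bot : (⊥ : Language α).IsRegular := by
  rw [Language.isRegular_iff_finite_range_leftQuotient]
  refine (Set.finite_singleton (⊥ : Language α)).subset ?_
  rintro _ ⟨w, rfl⟩
  rfl

theorem isRegular_biUnion {ι : Type*} {s : Set ι} (hs : s.Finite) {L : ι → Language α}
    (hL : ∀ i ∈ s, (L i).IsRegular) :
    Language.IsRegular ({w | ∃ i ∈ s, w ∈ L i} : Language α) := by
  induction s, hs using Set.Finite.induction_on with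
  | empty =>
    have heq : ({w | ∃ i ∈ (∅ : Set ι), w ∈ L i} : Language α) = ⊥ := by
      ext w
      exact ⟨fun ⟨_, h, _⟩ => h.elim, fun h => h.elim⟩
    exact heq ▸ isRegular_bot
  | @insert i s _ _ ih =>
    have heq : ∀ M : Language α, (∀ w, w ∈ M ↔ ∃ j ∈ s, w ∈ L j) →
        ({w | ∃ j ∈ insert i s, w ∈ L j} : Language α) = L i + M := by
      intro M hM
      ext w
      change (∃ j ∈ insert i s, w ∈ L j) ↔ (w ∈ L i ∨ w ∈ M)
      rw [hM]
      simp
    rw [heq _ fun _ => Iff.rfl]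
    exact (hL i (Set.mem_insert _ _)).add (ih fun j hj => hL j (Set.mem_insert_of_mem _ hj))

theorem isRegular_obstLang [Finite α] : (obstLang α).IsRegular := by
  have heq : obstLang α = ({w | ∃ i ∈ {i : α × α × α | i.2.1 ≠ i.1 ∧ i.2.2 ≠ i.1},
      w ∈ langK i.1 i.2.1 i.2.2} : Language α) := by
    ext w
    constructor
    · rintro ⟨x, a, b, ha, hb, hw⟩
      exact ⟨(x, a, b), ⟨ha, hb⟩, hw⟩
    · rintro ⟨⟨x, a, b⟩, ⟨ha, hb⟩, hw⟩
      exact ⟨x, a, b, ha, hb, hw⟩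
  rw [heq]
  exact isRegular_biUnion (Set.toFinite _) fun i _ => isRegular_langK i.1 i.2.1 i.2.2

end Regular

end BigramDecoding

theorem theorem2 {α : Type*} [Finite α] :
    BigramDecoding.uniqLang α = (BigramDecoding.obstLang α)ᶜ ∧
      (BigramDecoding.uniqLang α).IsRegular := by
  rw [BigramDecoding.uniqLang_eq_compl_obstLang]
  exact ⟨rfl, BigramDecoding.isRegular_obstLang.compl⟩
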